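/- Let $\mathbb{k}$ be a finite field and $n$ a natural number. Order $\mathbb{R}^n$ componentwise, and for $s\in\mathbb{R}^n$, $r\in\mathbb{R}$ let $s+r$ be the vector obtained by adding $r$ to every component of $s$. An $n$-parameter persistence module is a functor $V$ from the poset $\mathbb{R}^n$ to $\mathbb{k}$-vector spaces; it is q-tame if all structure maps $V_{s-\varepsilon}\to V_s$ with $\varepsilon>0$ have finite rank, and its support is $\{s : V_s\neq 0\}$. Its shift $V[\varepsilon]$ is given by $V[\varepsilon]_s=V_{s+\varepsilon}$. For $\varepsilon\ge 0$, an $\varepsilon$-interleaving of $V$ and $W$ is a pair of morphisms $f:V\to W[\varepsilon]$, $g:W\to V[\varepsilon]$ such that $g[\varepsilon]\circ f: V\to V[2\varepsilon]$ and $f[\varepsilon]\circ g: W\to W[2\varepsilon]$ consist of structure maps, and the interleaving distance $d_I(V,W)\in[0,\infty]$ is the infimum of all $\varepsilon\ge 0$ for which an $\varepsilon$-interleaving exists. An observable morphism $\varphi:V\to W$ is a family of linear maps $\varphi_{s,s+\varepsilon}:V_s\to W_{s+\varepsilon}$ ($s\in\mathbb{R}^n$, $\varepsilon>0$) that commutes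 with the structure maps, i.e. the composites $V_s\to V_t\to W_{t+\varepsilon'}$ and $V_s\to W_{s+\varepsilon}\to W_{t+\varepsilon'}$ agree whenever $s\le t$ and $s+\varepsilon\le t+\varepsilon'$. Observable morphisms are composed by $(\psi\circ\varphi)_{s,s+\varepsilon}=\psi_{s+\varepsilon',s+\varepsilon}\circ\varphi_{s,s+\varepsilon'}$ for any $0<\varepsilon'<\varepsilon$, and the identities are given by the structure maps. Let $\mathbf{qtOb}_n$ be the resulting category of q-tame modules. Its isomorphism classes form an extended pseudometric space under $d_I$, also denoted by $\mathbf{qtOb}_n$. The persistent rank of $V$ is the function $$c^V:[0,\infty)\to\mathbb{N}\cup\{\infty\},\qquad c^V(\varepsilon)=\sup_{s\in\mathbb{R}^n}\operatorname{rk}\Bigl(\operatorname*{colim}_{\delta>0}V_{s-\delta}\longrightarrow \lim_{\delta>0}V_{s+\varepsilon+\delta}\Bigr),$$ where the map is the one induced by the structure maps; it only depends on the isomorphism class of $V$ in $\mathbf{qtOb}_n$. Let $A\subseteq\mathbf{qtOb}_n$ be a set of isomorphism classes such that 1. (uniformly bounded support) there is a bounded set $B\subseteq\mathbb{R}^n$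 such that every class in $A$ contains a module with support in $B$; 2. (uniformly bounded persistent rank) for every $\varepsilon>0$ there is $N\in\mathbb{N}$ such that $c^V(\varepsilon)\le N$ for all $V\in A$. Then $A$ is precompact, i.e. the closure of $A$ in $\mathbf{qtOb}_n$ is compact. -/

import Mathlib

open CategoryTheory CategoryTheory.Limits
open scoped NNReal ENNReal

universe u

/-- The poset `𝐑ⁿ`: real `n`-tuples with the componentwise order. -/
def Param (n : ℕ) : Type := Fin n → ℝ

namespace Param

variable {n : ℕ}

instance : PartialOrder (Param n) := inferInstanceAs (PartialOrder (Fin n → ℝ))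

/-- The vector `s + r`, obtained by adding the number `r` to every component of `s`. -/
def add (s : Param n) (r : ℝ) : Param n := fun i => s i + r

theorem add_le_add {s t : Param n} {a b : ℝ} (h : s ≤ t) (hab : a ≤ b) : s.add a ≤ t.add b :=
  fun i => _root_.add_le_add (h i) hab

theorem le_add (s : Param n) {r : ℝ} (hr : 0 ≤ r) : s ≤ s.add r :=
  fun i => le_add_of_nonneg_right (a := s i) hr

theorem add_le (s : Param n) {r : ℝ} (hr : r ≤ 0) : s.add r ≤ s :=
  fun i => add_le_of_nonpos_right (a := s i) hr

theorem add_add (s : Param n) (a b : ℝ) : (s.add a).add b = s.add (a + b) :=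
  funext fun i => _root_.add_assoc (s i) a b

/-- The monotone map `r ↦ s + r`. -/
theorem monotone_add (s : Param n) : Monotone s.add := fun _ _ h => add_le_add le_rfl h

end Param

/-- An `n`-parameter persistence module over `k`: a functor from `𝐑ⁿ` to `k`-vector spaces. -/
abbrev PersMod (k : Type u) [Field k] (n : ℕ) := Param n ⥤ ModuleCat.{u} k

namespace PersMod

variable {k : Type u} [Field k] {n : ℕ}

/-- The structure map `V_s ⟶ V_t` for `s ≤ t`. -/
abbrev str (V : PersMod k n) {s t : Param n} (h : s ≤ t) : V.obj s ⟶ V.obj t := V.map (homOfLE h)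

theorem str_comp (V : PersMod k n) {s t r : Param n} (h : s ≤ t) (h' : t ≤ r) :
    V.str h ≫ V.str h' = V.str (h.trans h') := by
  rw [← V.map_comp]; rfl

theorem str_comp_assoc (V : PersMod k n) {s t r : Param n} (h : s ≤ t) (h' : t ≤ r)
    {X : ModuleCat.{u} k} (x : V.obj r ⟶ X) :
    V.str h ≫ V.str h' ≫ x = V.str (h.trans h') ≫ x := by
  rw [← Category.assoc, str_comp]

theorem str_refl (V : PersMod k n) {s : Param n} (h : s ≤ s) : V.str h = 𝟙 _ := V.map_id s

/-- `V` is q-tame if all structure maps `V_{s - ε} ⟶ V_s`, `ε > 0`, have finite rank. -/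
def QTame (V : PersMod k n) : Prop :=
  ∀ (s : Param n) (ε : ℝ) (hε : 0 < ε),
    FiniteDimensional k
      (LinearMap.range (V.str (s.add_le (neg_nonpos.2 hε.le) : s.add (-ε) ≤ s)).hom)

/-- The support of a persistence module: the set of all `s` such that `V_s ≠ 0`. -/
def support (V : PersMod k n) : Set (Fin n → ℝ) := {s | Nontrivial (V.obj (s : Param n))}

/-- The shift `V[r]`, with `V[r]_s = V_{s + r}`. -/
def shift (V : PersMod k n) (r : ℝ) : PersMod k n where
  obj s := V.obj (s.add r)
  map f := V.str (Param.add_le_add (leOfHom f) le_rfl)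
  map_id _ := V.str_refl _
  map_comp _ _ := (V.str_comp _ _).symm

/-- The component `V_s ⟶ W_{s + r}` of a morphism `V ⟶ W[r]`. -/
def shiftApp {V W : PersMod k n} {r : ℝ} (f : V ⟶ W.shift r) (s : Param n) :
    V.obj s ⟶ W.obj (s.add r) := f.app s

/-- `V` and `W` are `ε`-interleaved: there are morphisms `f : V ⟶ W[ε]` and `g : W ⟶ V[ε]` such
that `g[ε] ∘ f : V ⟶ V[2ε]` and `f[ε] ∘ g : W ⟶ W[2ε]` consist of structure maps. -/
def Interleaved (V W : PersMod k n) (ε : ℝ≥0) : Prop :=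
  ∃ (f : V ⟶ W.shift ε) (g : W ⟶ V.shift ε),
    (∀ s : Param n, shiftApp f s ≫ shiftApp g (s.add ε) =
      V.str ((s.le_add ε.coe_nonneg).trans ((s.add ε).le_add ε.coe_nonneg))) ∧
    (∀ s : Param n, shiftApp g s ≫ shiftApp f (s.add ε) =
      W.str ((s.le_add ε.coe_nonneg).trans ((s.add ε).le_add ε.coe_nonneg)))

/-- The interleaving distance (the infimum of the empty set is `∞`). -/
noncomputable def interleavingDist (V W : PersMod k n) : ℝ≥0∞ :=
  ⨅ (ε : ℝ≥0) (_ : Interleaved V W ε), (ε : ℝ≥0∞)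

/-- The diagram `r ↦ V_{s + r}`, `r < 0`. -/
abbrev belowDiagram (V : PersMod k n) (s : Param n) : Set.Iio (0 : ℝ) ⥤ ModuleCat.{u} k :=
  (show Monotone fun r : Set.Iio (0 : ℝ) => s.add r from fun _ _ h => s.monotone_add h).functor ⋙ V

/-- The diagram `r ↦ V_{s + r}`, `r > 0`. -/
abbrev aboveDiagram (V : PersMod k n) (s : Param n) : Set.Ioi (0 : ℝ) ⥤ ModuleCat.{u} k :=
  (show Monotone fun r : Set.Ioi (0 : ℝ) => s.add r from fun _ _ h => s.monotone_add h).functor ⋙ V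

/-- The value at `s` of the lower envelope of `V`: the colimit of `V_{s - δ}`, `δ > 0`. -/
noncomputable def lowerEnvelope (V : PersMod k n) (s : Param n) : ModuleCat.{u} k :=
  colimit (V.belowDiagram s)

/-- The value at `s` of the upper envelope of `V`: the limit of `V_{s + δ}`, `δ > 0`. -/
noncomputable def upperEnvelope (V : PersMod k n) (s : Param n) : ModuleCat.{u} k :=
  limit (V.aboveDiagram s)

/-- The canonical map from `V_{s + r}`, `r < 0`, to the lower envelope at `s`. -/
noncomputable def lowerι (V : PersMod k n) (s : Param n) {r : ℝ} (hr : r < 0) :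
    V.obj (s.add r) ⟶ V.lowerEnvelope s :=
  colimit.ι (V.belowDiagram s) ⟨r, hr⟩

/-- The canonical map from the upper envelope at `s` to `V_{s + r}`, `r > 0`. -/
noncomputable def upperπ (V : PersMod k n) (s : Param n) {r : ℝ} (hr : 0 < r) :
    V.upperEnvelope s ⟶ V.obj (s.add r) :=
  limit.π (V.aboveDiagram s) ⟨r, hr⟩

theorem lowerι_w (V : PersMod k n) (s : Param n) {r q : ℝ} (hr : r < 0) (hq : q < 0)
    (h : r ≤ q) : V.str (Param.add_le_add le_rfl h) ≫ V.lowerι s hq = V.lowerι s hr :=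
  colimit.w (V.belowDiagram s) (homOfLE (show (⟨r, hr⟩ : Set.Iio (0 : ℝ)) ≤ ⟨q, hq⟩ from h))

theorem upperπ_w (V : PersMod k n) (s : Param n) {r q : ℝ} (hr : 0 < r) (hq : 0 < q)
    (h : r ≤ q) : V.upperπ s hr ≫ V.str (Param.add_le_add le_rfl h) = V.upperπ s hq :=
  limit.w (V.aboveDiagram s) (homOfLE (show (⟨r, hr⟩ : Set.Ioi (0 : ℝ)) ≤ ⟨q, hq⟩ from h))

/-- The map out of the lower envelope at `s` induced by a compatible family of maps. -/
noncomputable def lowerDesc (V : PersMod k n) (s : Param n) {X : ModuleCat.{u} k}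
    (f : ∀ r : ℝ, r < 0 → (V.obj (s.add r) ⟶ X))
    (hf : ∀ (r q : ℝ) (hr : r < 0) (hq : q < 0) (h : r ≤ q),
      V.str (Param.add_le_add le_rfl h) ≫ f q hq = f r hr) : V.lowerEnvelope s ⟶ X :=
  colimit.desc (V.belowDiagram s)
    { pt := X
      ι := { app := fun r => f r r.2
             naturality := fun r q h =>
              (hf r q r.2 q.2 (leOfHom h)).trans (Category.comp_id _).symm } }

/-- The map into the upper envelope at `s` induced by a compatible family of maps. -/
noncomputable def upperLift (V : PersMod k n) (s : Param n) {X : ModuleCat.{u} k}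
    (f : ∀ r : ℝ, 0 < r → (X ⟶ V.obj (s.add r)))
    (hf : ∀ (r q : ℝ) (hr : 0 < r) (hq : 0 < q) (h : r ≤ q),
      f r hr ≫ V.str (Param.add_le_add le_rfl h) = f q hq) : X ⟶ V.upperEnvelope s :=
  limit.lift (V.aboveDiagram s)
    { pt := X
      π := { app := fun r => f r r.2
             naturality := fun r q h =>
              (Category.id_comp _).trans (hf r q r.2 q.2 (leOfHom h)).symm } }

theorem lowerι_desc (V : PersMod k n) (s : Param n) {X : ModuleCat.{u} k}
    (f : ∀ r : ℝ, r < 0 → (V.obj (s.add r) ⟶ X))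
    (hf : ∀ (r q : ℝ) (hr : r < 0) (hq : q < 0) (h : r ≤ q),
      V.str (Param.add_le_add le_rfl h) ≫ f q hq = f r hr) {r : ℝ} (hr : r < 0) :
    V.lowerι s hr ≫ V.lowerDesc s f hf = f r hr :=
  colimit.ι_desc _ _

theorem upperLift_π (V : PersMod k n) (s : Param n) {X : ModuleCat.{u} k}
    (f : ∀ r : ℝ, 0 < r → (X ⟶ V.obj (s.add r)))
    (hf : ∀ (r q : ℝ) (hr : 0 < r) (hq : 0 < q) (h : r ≤ q),
      f r hr ≫ V.str (Param.add_le_add le_rfl h) = f q hq) {r : ℝ} (hr : 0 < r) :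
    V.upperLift s f hf ≫ V.upperπ s hr = f r hr :=
  limit.lift_π _ _

theorem lower_ext (V : PersMod k n) (s : Param n) {X : ModuleCat.{u} k}
    {f g : V.lowerEnvelope s ⟶ X}
    (h : ∀ (r : ℝ) (hr : r < 0), V.lowerι s hr ≫ f = V.lowerι s hr ≫ g) : f = g :=
  colimit.hom_ext fun r => h r r.2

theorem upper_ext (V : PersMod k n) (s : Param n) {X : ModuleCat.{u} k}
    {f g : X ⟶ V.upperEnvelope s}
    (h : ∀ (r : ℝ) (hr : 0 < r), f ≫ V.upperπ s hr = g ≫ V.upperπ s hr) : f = g :=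
  limit.hom_ext fun r => h r r.2

/-- The canonical map from the lower envelope to `V`, induced by the structure maps. -/
noncomputable def fromLower (V : PersMod k n) (s : Param n) : V.lowerEnvelope s ⟶ V.obj s :=
  V.lowerDesc s (fun _ hr => V.str (s.add_le hr.le)) fun _ _ _ _ _ => V.str_comp _ _

/-- The canonical map from `V` to the upper envelope, induced by the structure maps. -/
noncomputable def toUpper (V : PersMod k n) (s : Param n) : V.obj s ⟶ V.upperEnvelope s :=
  V.upperLift s (fun _ hr => V.str (s.le_add hr.le)) fun _ _ _ _ _ => V.str_comp _ _

theorem lowerι_fromLower (V : PersMod k n) (s : Param n) {r : ℝ} (hr : r < 0) :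
    V.lowerι s hr ≫ V.fromLower s = V.str (s.add_le hr.le) :=
  V.lowerι_desc s _ _ hr

theorem toUpper_upperπ (V : PersMod k n) (s : Param n) {r : ℝ} (hr : 0 < r) :
    V.toUpper s ≫ V.upperπ s hr = V.str (s.le_add hr.le) :=
  V.upperLift_π s _ _ hr

/-- The canonical map from the lower envelope at `s` to the upper envelope at `s + ε`. -/
noncomputable def lowerToUpper (V : PersMod k n) (ε : ℝ≥0) (s : Param n) :
    V.lowerEnvelope s ⟶ V.upperEnvelope (s.add ε) :=
  V.fromLower s ≫ V.str (s.le_add ε.coe_nonneg) ≫ V.toUpper (s.add ε)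

/-- The persistent rank `c^V : [0, ∞) → ℕ ∪ {∞}` of `V`. -/
noncomputable def persistentRank (V : PersMod k n) (ε : ℝ≥0) : ℕ∞ :=
  ⨆ s : Param n, Cardinal.toENat (LinearMap.rank (V.lowerToUpper ε s).hom)

end PersMod

namespace PersMod

variable {k : Type u} [Field k] {n : ℕ}

theorem shiftApp_naturality {V W : PersMod k n} {r : ℝ} (f : V ⟶ W.shift r) {s t : Param n}
    (h : s ≤ t) : V.str h ≫ shiftApp f t = shiftApp f s ≫ W.str (Param.add_le_add h le_rfl) :=
  f.naturality (homOfLE h)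

theorem shiftApp_naturality_assoc {V W : PersMod k n} {r : ℝ} (f : V ⟶ W.shift r) {s t : Param n}
    (h : s ≤ t) {X : ModuleCat.{u} k} (x : W.obj (t.add r) ⟶ X) :
    V.str h ≫ shiftApp f t ≫ x =
      shiftApp f s ≫ W.str (Param.add_le_add h le_rfl) ≫ x := by
  rw [← Category.assoc, shiftApp_naturality, Category.assoc]

/-- A family of maps `V_s ⟶ W_{s + r}` commuting with the structure maps is a morphism. -/
def mkShift {V W : PersMod k n} {r : ℝ} (f : ∀ s : Param n, V.obj s ⟶ W.obj (s.add r))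
    (hf : ∀ (s t : Param n) (h : s ≤ t),
      V.str h ≫ f t = f s ≫ W.str (Param.add_le_add h le_rfl)) : V ⟶ W.shift r where
  app s := f s
  naturality s t h := hf s t (leOfHom h)

theorem Interleaved.refl (V : PersMod k n) : Interleaved V V 0 := by
  let f : V ⟶ V.shift ((0 : ℝ≥0) : ℝ) := mkShift (fun s => V.str (s.le_add (0 : ℝ≥0).coe_nonneg))
    (fun s t h => (V.str_comp h _).trans (V.str_comp _ _).symm)
  exact ⟨f, f, fun s => V.str_comp _ _, fun s => V.str_comp _ _⟩

theorem Interleaved.symm {V W : PersMod k n} {ε : ℝ≥0} (h : Interleaved V W ε) :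
    Interleaved W V ε :=
  let ⟨f, g, hf, hg⟩ := h
  ⟨g, f, hg, hf⟩

theorem Interleaved.trans {V W U : PersMod k n} {a b : ℝ≥0} (h : Interleaved V W a)
    (h' : Interleaved W U b) : Interleaved V U (a + b) := by
  have le : ∀ {a b c : ℝ≥0} (_ : c = a + b) (s : Param n), (s.add a).add b ≤ s.add c :=
    fun hc s => le_of_eq (by rw [Param.add_add, hc]; rfl)
  let C : ∀ {V W U : PersMod k n} {a b c : ℝ≥0} (_ : c = a + b) (f : V ⟶ W.shift a)
      (g : W ⟶ U.shift b), V ⟶ U.shift c := fun {V W U a b c} hc f g =>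
    mkShift (fun s => shiftApp f s ≫ shiftApp g (s.add a) ≫ U.str (le hc s)) (fun s t h => by
      simp only [shiftApp_naturality_assoc, Category.assoc, str_comp])
  have key : ∀ {V W U : PersMod k n} {a b c : ℝ≥0} (hc : c = a + b) (hc' : c = b + a)
      (f : V ⟶ W.shift a) (g : W ⟶ V.shift a) (f' : W ⟶ U.shift b) (g' : U ⟶ W.shift b)
      (_ : ∀ s : Param n, shiftApp f s ≫ shiftApp g (s.add a) =
        V.str ((s.le_add a.coe_nonneg).trans ((s.add a).le_add a.coe_nonneg)))
      (_ : ∀ s : Param n, shiftApp f' s ≫ shiftApp g' (s.add b) =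
        W.str ((s.le_add b.coe_nonneg).trans ((s.add b).le_add b.coe_nonneg))) (s : Param n),
      shiftApp (C hc f f') s ≫ shiftApp (C hc' g' g) (s.add c) =
        V.str ((s.le_add c.coe_nonneg).trans ((s.add c).le_add c.coe_nonneg)) := by
    intro V W U a b c hc hc' f g f' g' h1 h2 s
    change (shiftApp f s ≫ shiftApp f' (s.add a) ≫ U.str (le hc s)) ≫
      (shiftApp g' (s.add c) ≫ shiftApp g ((s.add c).add b) ≫ V.str (le hc' (s.add c))) = _
    simp only [Category.assoc, shiftApp_naturality_assoc]
    rw [reassoc_of% (h2 (s.add a))]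
    simp only [shiftApp_naturality_assoc, str_comp]
    rw [reassoc_of% (h1 s), str_comp]
  obtain ⟨f, g, h1, h2⟩ := h
  obtain ⟨f', g', h1', h2'⟩ := h'
  have hc : a + b = b + a := add_comm a b
  exact ⟨C rfl f f', C hc g' g, key rfl hc f g f' g' h1 h1', key hc rfl g' f' g f h2' h2⟩

theorem interleavingDist_self (V : PersMod k n) : interleavingDist V V = 0 :=
  le_antisymm (iInf₂_le_of_le 0 (Interleaved.refl V) (by simp)) zero_le

theorem interleavingDist_comm (V W : PersMod k n) :
    interleavingDist V W = interleavingDist W V :=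
  iInf_congr fun _ => iInf_congr_Prop ⟨Interleaved.symm, Interleaved.symm⟩ fun _ => rfl

theorem interleavingDist_triangle (V W U : PersMod k n) :
    interleavingDist V U ≤ interleavingDist V W + interleavingDist W U := by
  unfold interleavingDist
  simp only [ENNReal.iInf_add, ENNReal.add_iInf]
  refine le_iInf₂ fun b hb => le_iInf₂ fun a ha => ?_
  refine iInf₂_le_of_le (a + b) (ha.trans hb) ?_
  simp

end PersMod

/-- An object of the observable category: an `n`-parameter persistence module. -/
structure Ob (k : Type u) [Field k] (n : ℕ) where
  /-- The underlying persistence module. -/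
  toMod : PersMod k n

namespace Ob

variable {k : Type u} [Field k] {n : ℕ}

/-- A morphism `V ⟶ W` in the observable category: a family of maps `V_s ⟶ W_{s + r}`, `r > 0`,
compatible with the structure maps of `V` and `W`. -/
@[ext]
structure Hom (V W : Ob k n) where
  /-- The map `V_s ⟶ W_{s + r}`. -/
  app (s : Param n) (r : ℝ) (hr : 0 < r) : V.toMod.obj s ⟶ W.toMod.obj (s.add r)
  naturality (s t : Param n) (r q : ℝ) (hr : 0 < r) (hq : 0 < q) (h : s ≤ t)
    (h' : s.add r ≤ t.add q) :
    V.toMod.str h ≫ app t q hq = app s r hr ≫ W.toMod.str h'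

theorem half_neg {r : ℝ} (hr : r < 0) : r / 2 < 0 := by linarith

theorem add_neg_half_le (s : Param n) (r : ℝ) : (s.add r).add (-r / 2) ≤ s.add (r / 2) :=
  le_of_eq (by rw [Param.add_add]; congr 1; ring)

theorem half_le (s : Param n) (r : ℝ) : (s.add (r / 2)).add (r / 2) ≤ s.add r :=
  le_of_eq (by rw [Param.add_add, add_halves])

theorem Hom.comp_aux {V W U : Ob k n} (φ : Hom V W) (ψ : Hom W U) {s t : Param n}
    {a b a' b' : ℝ} (ha : 0 < a) (hb : 0 < b) (ha' : 0 < a') (hb' : 0 < b') {x : Param n}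
    (h : s ≤ t) (h₁ : (s.add a).add b ≤ x) (h₂ : (t.add a').add b' ≤ x) :
    V.toMod.str h ≫ φ.app t a' ha' ≫ ψ.app (t.add a') b' hb' ≫ U.toMod.str h₂ =
      φ.app s a ha ≫ ψ.app (s.add a) b hb ≫ U.toMod.str h₁ := by
  have hm : 0 < min a a' := lt_min ha ha'
  have hq : 0 < min b b' := lt_min hb hb'
  have e1 : s.add (min a a') ≤ s.add a := Param.add_le_add le_rfl (min_le_left _ _)
  have e2 : s.add (min a a') ≤ t.add a' := Param.add_le_add h (min_le_right _ _)
  have n1 := φ.naturality s s (min a a') a hm ha le_rfl e1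
  rw [PersMod.str_refl, Category.id_comp] at n1
  have n2 := φ.naturality s t (min a a') a' hm ha' h e2
  have n3 := ψ.naturality _ _ (min b b') b hq hb e1 (Param.add_le_add e1 (min_le_left _ _))
  have n4 := ψ.naturality _ _ (min b b') b' hq hb' e2 (Param.add_le_add e2 (min_le_right _ _))
  rw [reassoc_of% n2, reassoc_of% n4, n1, Category.assoc, reassoc_of% n3]
  simp only [PersMod.str_comp]

/-- Composition of observable morphisms, through the intermediate point `s + r / 2`. -/
noncomputable def Hom.comp {V W U : Ob k n} (φ : Hom V W) (ψ : Hom W U) : Hom V U where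
  app s r hr := φ.app s (r / 2) (half_pos hr) ≫ ψ.app (s.add (r / 2)) (r / 2) (half_pos hr) ≫
    U.toMod.str (half_le s r)
  naturality s t r q hr hq h h' := by
    simp only [Category.assoc, PersMod.str_comp]
    exact Hom.comp_aux φ ψ _ _ _ _ h ((half_le s r).trans h') (half_le t q)

/-- The composite can be computed through any intermediate point. -/
theorem Hom.comp_app {V W U : Ob k n} (φ : Hom V W) (ψ : Hom W U) (s : Param n) {a b r : ℝ}
    (ha : 0 < a) (hb : 0 < b) (hr : 0 < r) (h : (s.add a).add b ≤ s.add r) :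
    φ.app s a ha ≫ ψ.app (s.add a) b hb ≫ U.toMod.str h = (φ.comp ψ).app s r hr := by
  have := Hom.comp_aux φ ψ (half_pos hr) (half_pos hr) ha hb (le_refl s) (half_le s r) h
  rwa [PersMod.str_refl, Category.id_comp] at this

/-- The identity is given by the structure maps. -/
def Hom.id (V : Ob k n) : Hom V V where
  app s _ hr := V.toMod.str (s.le_add hr.le)
  naturality _ _ _ _ _ _ _ _ := by simp only [PersMod.str_comp]

theorem Hom.app_str {V W : Ob k n} (φ : Hom V W) (s : Param n) {a b : ℝ} (ha : 0 < a)
    (hb : 0 < b) (h : s.add a ≤ s.add b) : φ.app s a ha ≫ W.toMod.str h = φ.app s b hb := by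
  rw [← φ.naturality s s a b ha hb le_rfl h, PersMod.str_refl, Category.id_comp]

noncomputable instance : Category (Ob k n) where
  Hom := Hom
  id := Hom.id
  comp := Hom.comp
  id_comp {V W} φ := by
    refine Hom.ext (funext fun s => funext fun r => funext fun hr => ?_)
    change V.toMod.str _ ≫ φ.app _ _ _ ≫ W.toMod.str _ = _
    rw [← Category.assoc, φ.naturality s _ (r / 2) (r / 2) (half_pos hr) (half_pos hr) _
      (Param.add_le_add (s.le_add (half_pos hr).le) le_rfl), Category.assoc, PersMod.str_comp]
    exact φ.app_str _ _ _ _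
  comp_id {V W} φ := by
    refine Hom.ext (funext fun s => funext fun r => funext fun hr => ?_)
    change φ.app _ _ _ ≫ W.toMod.str _ ≫ W.toMod.str _ = _
    rw [PersMod.str_comp]
    exact φ.app_str _ _ _ _
  assoc {V W U X} φ ψ χ := by
    refine Hom.ext (funext fun s => funext fun r => funext fun hr => ?_)
    have hq : 0 < r / 4 := by positivity
    have h2 : 0 < r / 2 := half_pos hr
    have e1 : (s.add (r / 4)).add (r / 4) ≤ s.add (r / 2) :=
      le_of_eq (by rw [Param.add_add]; congr 1; ring)
    have e2 : ((s.add (r / 4)).add (r / 4)).add (r / 2) ≤ s.add r :=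
      le_of_eq (by rw [Param.add_add, Param.add_add]; congr 1; ring)
    have e3 : ((s.add (r / 4)).add (r / 4)).add (r / 4) ≤ (s.add (r / 4)).add (r * 3 / 4) :=
      (Param.add_le_add (le_of_eq (Param.add_add _ _ _)) le_rfl).trans
        ((le_of_eq (Param.add_add _ _ _)).trans ((Param.add_le_add le_rfl (by linarith)).trans
          (le_of_eq (Param.add_add _ _ _).symm)))
    have e4 : (s.add (r / 4)).add (r * 3 / 4) ≤ s.add r :=
      le_of_eq (by rw [Param.add_add]; congr 1; ring)
    have e5 : (s.add (r / 2)).add (r / 4) ≤ s.add r :=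
      (le_of_eq (Param.add_add _ _ _)).trans (Param.add_le_add le_rfl (by linarith))
    have h34 : 0 < r * 3 / 4 := by positivity
    have L := Hom.comp_app (φ.comp ψ) χ s h2 hq hr e5
    rw [← Hom.comp_app φ ψ s hq hq h2 e1] at L
    have R := Hom.comp_app φ (ψ.comp χ) s hq h34 hr e4
    rw [← Hom.comp_app ψ χ (s.add (r / 4)) hq hq h34 e3] at R
    refine L.symm.trans (Eq.trans ?_ R)
    have nt := χ.naturality _ _ (r / 4) (r / 4) hq hq e1 (Param.add_le_add e1 le_rfl)
    simp only [Category.assoc]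
    rw [reassoc_of% nt]
    simp only [PersMod.str_comp]

theorem Hom.comp_app_eq {V W U : Ob k n} (φ : V ⟶ W) (ψ : W ⟶ U) (s : Param n) {a b r : ℝ}
    (ha : 0 < a) (hb : 0 < b) (hr : 0 < r) (h : (s.add a).add b ≤ s.add r) :
    Hom.app φ s a ha ≫ Hom.app ψ (s.add a) b hb ≫ U.toMod.str h = Hom.app (φ ≫ ψ) s r hr :=
  Hom.comp_app φ ψ s ha hb hr h

theorem Hom.id_app {V : Ob k n} (s : Param n) (r : ℝ) (hr : 0 < r) :
    Hom.app (𝟙 V) s r hr = V.toMod.str (s.le_add hr.le) := rfl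

/-- Mutually inverse observable morphisms compose to structure maps. -/
theorem iso_app {V W : Ob k n} (e : V ≅ W) (s : Param n) {a b : ℝ} (ha : 0 < a) (hb : 0 < b) :
    Hom.app e.hom s a ha ≫ Hom.app e.inv (s.add a) b hb =
      V.toMod.str ((s.le_add ha.le).trans ((s.add a).le_add hb.le)) := by
  have h : (s.add a).add b ≤ s.add (a + b) := le_of_eq (Param.add_add _ _ _)
  have h' : s.add (a + b) ≤ (s.add a).add b := le_of_eq (Param.add_add _ _ _).symm
  have := Hom.comp_app_eq e.hom e.inv s ha hb (add_pos ha hb) h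
  rw [e.hom_inv_id, Hom.id_app] at this
  have t := congrArg (· ≫ V.toMod.str h') this
  simpa only [Category.assoc, PersMod.str_comp, PersMod.str_refl, Category.comp_id] using t

/-- Observably isomorphic modules are at interleaving distance zero. -/
theorem interleavingDist_eq_zero {V W : Ob k n} (e : V ≅ W) :
    PersMod.interleavingDist V.toMod W.toMod = 0 := by
  refine le_antisymm (ENNReal.le_of_forall_pos_le_add fun ε hε _ => ?_) zero_le
  have hε' : (0 : ℝ) < ε := hε
  rw [zero_add]
  have nat : ∀ {V W : Ob k n} (φ : V ⟶ W) (s t : Param n) (h : s ≤ t),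
      V.toMod.str h ≫ Hom.app φ t ε hε' =
        Hom.app φ s ε hε' ≫ W.toMod.str (Param.add_le_add h le_rfl) :=
    fun φ s t h => Hom.naturality φ s t ε ε hε' hε' h _
  exact iInf₂_le_of_le ε ⟨PersMod.mkShift (fun s => Hom.app e.hom s ε hε') (nat e.hom),
    PersMod.mkShift (fun s => Hom.app e.inv s ε hε') (nat e.inv),
    fun s => iso_app e s hε' hε', fun s => iso_app e.symm s hε' hε'⟩ le_rfl

theorem interleavingDist_congr {V V' W W' : Ob k n} (e : V ≅ V') (e' : W ≅ W') :
    PersMod.interleavingDist V.toMod W.toMod = PersMod.interleavingDist V'.toMod W'.toMod := by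
  have key : ∀ {V V' W W' : Ob k n} (_ : V ≅ V') (_ : W ≅ W'),
      PersMod.interleavingDist V.toMod W.toMod ≤ PersMod.interleavingDist V'.toMod W'.toMod := by
    intro V V' W W' e e'
    refine (PersMod.interleavingDist_triangle _ V'.toMod _).trans ?_
    rw [interleavingDist_eq_zero e, zero_add]
    refine (PersMod.interleavingDist_triangle _ W'.toMod _).trans ?_
    rw [interleavingDist_eq_zero e'.symm, add_zero]
  exact le_antisymm (key e e') (key e.symm e'.symm)

/-- The map on lower envelopes induced by an observable morphism. -/
noncomputable def lowerMap {V W : Ob k n} (φ : V ⟶ W) (s : Param n) :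
    V.toMod.lowerEnvelope s ⟶ W.toMod.lowerEnvelope s :=
  V.toMod.lowerDesc s
    (fun r hr => Hom.app φ (s.add r) (-r / 2) (half_pos (neg_pos.2 hr)) ≫
      W.toMod.str (add_neg_half_le s r) ≫ W.toMod.lowerι s (half_neg hr))
    (fun r q hr hq h => by
      have hn := Hom.naturality φ (s.add r) (s.add q) (-r / 2) (-q / 2)
        (half_pos (neg_pos.2 hr)) (half_pos (neg_pos.2 hq)) (Param.add_le_add le_rfl h) (by
          rw [Param.add_add, Param.add_add]
          exact Param.add_le_add le_rfl (by linarith))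
      rw [reassoc_of% hn, ← W.toMod.lowerι_w s (half_neg hr) (half_neg hq) (by linarith)]
      simp only [PersMod.str_comp_assoc])

/-- The map on upper envelopes induced by an observable morphism. -/
noncomputable def upperMap {V W : Ob k n} (φ : V ⟶ W) (s : Param n) :
    V.toMod.upperEnvelope s ⟶ W.toMod.upperEnvelope s :=
  W.toMod.upperLift s
    (fun r hr => V.toMod.upperπ s (half_pos hr) ≫
      Hom.app φ (s.add (r / 2)) (r / 2) (half_pos hr) ≫ W.toMod.str (half_le s r))
    (fun r q hr hq h => by
      have hh : r / 2 ≤ q / 2 := by linarith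
      have hn := Hom.naturality φ (s.add (r / 2)) (s.add (q / 2)) (r / 2) (q / 2)
        (half_pos hr) (half_pos hq) (Param.add_le_add le_rfl hh)
        (Param.add_le_add (Param.add_le_add le_rfl hh) hh)
      rw [← V.toMod.upperπ_w s (half_pos hr) (half_pos hq) hh]
      simp only [Category.assoc]
      rw [reassoc_of% hn]
      simp only [PersMod.str_comp])

theorem lowerMap_lowerToUpper {V W : Ob k n} (e : V ≅ W) (ε : ℝ≥0) (s : Param n) :
    lowerMap e.hom s ≫ W.toMod.lowerToUpper ε s ≫ upperMap e.inv (s.add ε) =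
      V.toMod.lowerToUpper ε s := by
  refine V.toMod.lower_ext s fun r hr => V.toMod.upper_ext (s.add ε) fun q hq => ?_
  have h1 : V.toMod.lowerι s hr ≫ lowerMap e.hom s =
      Hom.app e.hom (s.add r) (-r / 2) (half_pos (neg_pos.2 hr)) ≫
        W.toMod.str (add_neg_half_le s r) ≫ W.toMod.lowerι s (half_neg hr) :=
    V.toMod.lowerι_desc s _ _ hr
  have h2 : upperMap e.inv (s.add ε) ≫ V.toMod.upperπ (s.add ε) hq =
      W.toMod.upperπ (s.add ε) (half_pos hq) ≫
        Hom.app e.inv ((s.add ε).add (q / 2)) (q / 2) (half_pos hq) ≫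
          V.toMod.str (half_le (s.add ε) q) :=
    V.toMod.upperLift_π (s.add ε) _ _ hq
  have h3 := V.toMod.lowerι_fromLower s hr
  have h4 := V.toMod.toUpper_upperπ (s.add ε) hq
  have h5 := W.toMod.lowerι_fromLower s (half_neg hr)
  have h6 := W.toMod.toUpper_upperπ (s.add ε) (half_pos hq)
  have hle : (s.add r).add (-r / 2) ≤ (s.add ε).add (q / 2) := by
    have := ε.coe_nonneg
    simp only [Param.add_add]
    exact Param.add_le_add le_rfl (by linarith)
  have hn := Hom.naturality e.inv _ _ (q / 2) (q / 2) (half_pos hq) (half_pos hq) hle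
    (Param.add_le_add hle le_rfl)
  simp only [PersMod.lowerToUpper, Category.assoc]
  rw [reassoc_of% h1, h2, reassoc_of% h5, reassoc_of% h6, reassoc_of% h3, h4]
  simp only [PersMod.str_comp_assoc, PersMod.str_comp]
  rw [reassoc_of% hn, reassoc_of% (iso_app e (s.add r) (half_pos (neg_pos.2 hr)) (half_pos hq))]
  simp only [PersMod.str_comp]

theorem persistentRank_congr {V W : Ob k n} (e : V ≅ W) (ε : ℝ≥0) :
    V.toMod.persistentRank ε = W.toMod.persistentRank ε := by
  have key : ∀ {V W : Ob k n} (_ : V ≅ W),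
      V.toMod.persistentRank ε ≤ W.toMod.persistentRank ε := by
    intro V W e
    refine iSup_mono fun s => Cardinal.toENat.monotone' ?_
    rw [← lowerMap_lowerToUpper e ε s, ModuleCat.hom_comp, ModuleCat.hom_comp]
    exact (LinearMap.rank_comp_le_left _ _).trans (LinearMap.rank_comp_le_right _ _)
  exact le_antisymm (key e) (key e.symm)

/-- The q-tame objects of the observable category. -/
noncomputable def isQTame (k : Type u) [Field k] (n : ℕ) : ObjectProperty (Ob k n) := fun V => V.toMod.QTame

end Ob

/-- The observable category of q-tame `n`-parameter persistence modules. -/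
abbrev QtOb (k : Type u) [Field k] (n : ℕ) := (Ob.isQTame k n).FullSubcategory

/-- The space of isomorphism classes of observable q-tame `n`-parameter persistence modules. -/
def QtSpace (k : Type u) [Field k] (n : ℕ) := Quotient (isIsomorphicSetoid (QtOb k n))

namespace QtSpace

variable {k : Type u} [Field k] {n : ℕ}

/-- The isomorphism class of an observable q-tame module. -/
noncomputable def mk (V : QtOb k n) : QtSpace k n := Quotient.mk (isIsomorphicSetoid (QtOb k n)) V

/-- The isomorphism classes form an extended pseudometric space under the interleaving distance. -/
noncomputable instance : PseudoEMetricSpace (QtSpace k n) where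
  edist := Quotient.lift₂ (fun V W : QtOb k n => V.obj.toMod.interleavingDist W.obj.toMod)
    (fun _ _ _ _ h h' => Nonempty.elim h fun e => Nonempty.elim h' fun e' =>
      Ob.interleavingDist_congr ((Ob.isQTame k n).ι.mapIso e) ((Ob.isQTame k n).ι.mapIso e'))
  edist_self := Quotient.ind fun V => V.obj.toMod.interleavingDist_self
  edist_comm := Quotient.ind₂ fun V W => V.obj.toMod.interleavingDist_comm W.obj.toMod
  edist_triangle := fun x y z => Quotient.inductionOn₃ x y z fun V W U =>
    V.obj.toMod.interleavingDist_triangle W.obj.toMod U.obj.toMod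

/-- The persistent rank of an isomorphism class. -/
noncomputable def persistentRank (x : QtSpace k n) (ε : ℝ≥0) : ℕ∞ :=
  Quotient.lift (fun V : QtOb k n => V.obj.toMod.persistentRank ε)
    (fun _ _ h => Nonempty.elim h fun e => Ob.persistentRank_congr ((Ob.isQTame k n).ι.mapIso e) ε) x

/-- An isomorphism class is supported in `B` if it contains a module with support in `B`. -/
def SupportedIn (x : QtSpace k n) (B : Set (Fin n → ℝ)) : Prop :=
  ∃ V : QtOb k n, mk V = x ∧ V.obj.toMod.support ⊆ B

end QtSpace

/-! A totally bounded set in a complete extended pseudometric space has compact closure, so there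
are two things to prove: `A` is totally bounded, and the whole space is complete.

Total boundedness. Fix `δ > 0` and sample a module `V` on the grid `δℤⁿ`. The rank bound says that
the image `I_a` of `V_a ⟶ V_{a + 3δ}` has dimension at most some `N` independent of `V` and `a`, so
`I_a` is a retract of `k^N`, and the maps `I_a ⟶ I_b` become `N × N` matrices over `k`. They vanish
unless `a` and `b` both lie in `B`, which contains finitely many grid points; since `k` is finite,
only finitely many matrix families occur. The matrices determine `V` up to a `4δ`-interleaving:
compositions through a second module with the same matrices involve only these matrices
(`exists_gridFactorization`, `GridFactorization.interleaved`).

Completeness. Pass to a sequence whose consecutive terms are `2⁻ⁱ`-interleaved, and let `r_i = 2⁻ⁱ +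
2⁻⁽ⁱ⁺¹⁾ + …`. Shifting by these tails absorbs the interleaving parameters: the `V_i[-r_i]` form a
direct system and the `V_i[r_i]` an inverse system. The colimit of the former is `r_i`-interleaved
with `V_i` (`interleaved_colimit`); as `r_i → 0`, it is a limit of the sequence and inherits
q-tameness. -/

namespace PersMod

variable {k : Type u} [Field k] {n : ℕ}

/-! ### Rank bounds and sampling on a grid -/

/-- The structure map from `s` to `t` has rank at most `c^V(δ)` as soon as `t` exceeds `s` by more
than `δ`. -/
theorem rank_str_le {V : PersMod k n} {δ : ℝ≥0} {η : ℝ} (hη : 0 < η) {N : ℕ}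
    (hV : V.persistentRank δ ≤ N) {s t : Param n} (h : s ≤ t)
    (h' : ((s.add η).add δ).add η ≤ t) : LinearMap.rank (V.str h).hom ≤ N := by
  have h₁ : s ≤ (s.add η).add (-η) := le_of_eq (by
    rw [Param.add_add, add_neg_cancel]; exact funext fun i => (add_zero (s i)).symm)
  -- Taking envelopes at `s + η` and `s + η + δ` makes `V_s` a term of the colimit diagram and `V_{s
  -- + 2η + δ}` a term of the limit diagram, so the structure map passes through `lowerToUpper`.
  have e : V.str h = V.str h₁ ≫ V.lowerι (s.add η) (neg_neg_of_pos hη) ≫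
      V.lowerToUpper δ (s.add η) ≫ V.upperπ ((s.add η).add δ) hη ≫ V.str h' := by
    simp only [lowerToUpper, Category.assoc]
    rw [reassoc_of% V.lowerι_fromLower (s.add η) (neg_neg_of_pos hη),
      reassoc_of% V.toUpper_upperπ ((s.add η).add δ) hη]
    simp only [str_comp]
  have hr : LinearMap.rank (V.lowerToUpper δ (s.add η)).hom ≤ N :=
    Cardinal.toENat_le_natCast.1 ((le_iSup (fun s : Param n =>
      Cardinal.toENat (LinearMap.rank (V.lowerToUpper δ s).hom)) (s.add η)).trans hV)
  rw [e]
  simp only [ModuleCat.hom_comp]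
  exact (((LinearMap.rank_comp_le_left _ _).trans (LinearMap.rank_comp_le_left _ _)).trans
    (LinearMap.rank_comp_le_right _ _)).trans hr

/-- The point of the grid `δℤⁿ` with integer coordinates `z`. -/
def gridPoint (δ : ℝ) (z : Fin n → ℤ) : Param n := fun i => δ * z i

/-- The integer coordinates of the smallest point of the grid `δℤⁿ` above `s`. -/
noncomputable def gridCeil (δ : ℝ) (s : Param n) : Fin n → ℤ := fun i => ⌈s i / δ⌉

theorem gridPoint_mono {δ : ℝ} (hδ : 0 < δ) {a b : Fin n → ℤ} (h : a ≤ b) :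
    gridPoint δ a ≤ gridPoint δ b :=
  fun i => mul_le_mul_of_nonneg_left (Int.cast_le.2 (h i)) hδ.le

theorem gridCeil_mono {δ : ℝ} (hδ : 0 < δ) {s t : Param n} (h : s ≤ t) :
    gridCeil δ s ≤ gridCeil δ t :=
  fun i => Int.ceil_mono (div_le_div_of_nonneg_right (h i) hδ.le)

theorem le_gridPoint_gridCeil {δ : ℝ} (hδ : 0 < δ) (s : Param n) :
    s ≤ gridPoint δ (gridCeil δ s) :=
  fun i => (div_le_iff₀' hδ).1 (Int.le_ceil (s i / δ))

theorem gridPoint_gridCeil_le {δ : ℝ} (hδ : 0 < δ) (s : Param n) :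
    gridPoint δ (gridCeil δ s) ≤ s.add δ := fun i => by
  have h := mul_le_mul_of_nonneg_left (Int.ceil_lt_add_one (s i / δ)).le hδ.le
  rw [mul_add, mul_one, mul_div_cancel₀ _ hδ.ne'] at h
  exact h

theorem finite_gridPoint_mem {δ : ℝ} (hδ : 0 < δ) {B : Set (Fin n → ℝ)}
    (hB : Bornology.IsBounded B) : {z : Fin n → ℤ | (gridPoint δ z : Fin n → ℝ) ∈ B}.Finite := by
  obtain ⟨R, hR⟩ := hB.subset_closedBall 0
  refine (Set.finite_Icc (fun _ => -⌈R / δ⌉) (fun _ => ⌈R / δ⌉)).subset fun z hz => ?_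
  have h : ∀ i, |z i| ≤ ⌈R / δ⌉ := fun i => by
    have h₁ := (norm_le_pi_norm (gridPoint δ z : Fin n → ℝ) i).trans
      (mem_closedBall_zero_iff.1 (hR hz))
    rw [gridPoint, norm_mul, Real.norm_of_nonneg hδ.le, ← le_div_iff₀' hδ] at h₁
    have h₂ := h₁.trans (Int.le_ceil _)
    rw [Real.norm_eq_abs] at h₂
    exact_mod_cast h₂
  exact ⟨fun i => (abs_le.1 (h i)).1, fun i => (abs_le.1 (h i)).2⟩

/-- The structure maps `V_a ⟶ V_{a + 3δ}` at the points `a` of the grid `δℤⁿ`, factored through a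
fixed vector space `D` in such a way that the structure maps between grid points become the
endomorphisms `M a b` of `D`. -/
structure GridFactorization (V : PersMod k n) (δ : ℝ) (hδ : 0 < δ) (D : ModuleCat.{u} k)
    (M : (Fin n → ℤ) → (Fin n → ℤ) → (D ⟶ D)) where
  /-- The map from `V_a` to `D`. -/
  q (a : Fin n → ℤ) : V.obj (gridPoint δ a) ⟶ D
  /-- The map from `D` to `V_{a + 3δ}`. -/
  j (a : Fin n → ℤ) : D ⟶ V.obj ((gridPoint δ a).add (3 * δ))
  q_j (a : Fin n → ℤ) : q a ≫ j a = V.str ((gridPoint δ a).le_add (by positivity))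
  str_q (a b : Fin n → ℤ) (h : a ≤ b) : V.str (gridPoint_mono hδ h) ≫ q b = q a ≫ M a b
  j_str (a b : Fin n → ℤ) (h : a ≤ b) :
    j a ≫ V.str (Param.add_le_add (gridPoint_mono hδ h) le_rfl) = M a b ≫ j b
  j_str_q (a b : Fin n → ℤ) (h : a ≤ b) (h' : (gridPoint δ a).add (3 * δ) ≤ gridPoint δ b) :
    j a ≫ V.str h' ≫ q b = M a b

/-- `D = k^N` contains the image of each `V_a ⟶ V_{a + 3δ}` as a retract: `q` is corestriction
followed by the embedding, `j` is the retraction followed by inclusion, and `M a b` is the induced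
map of images conjugated by these. -/
theorem exists_gridFactorization (V : PersMod k n) (δ : ℝ≥0) (hδ : 0 < (δ : ℝ)) {N : ℕ}
    (hV : V.persistentRank δ ≤ N) {B : Set (Fin n → ℝ)} (hB : V.support ⊆ B) :
    ∃ M, Nonempty (GridFactorization V δ hδ (ModuleCat.of k (Fin N → k)) M) ∧
      ∀ a b, ((gridPoint δ a : Fin n → ℝ) ∈ B → (gridPoint δ b : Fin n → ℝ) ∉ B) → M a b = 0 := by
  have h3 : (0 : ℝ) ≤ 3 * δ := by positivity
  let φ := fun a : Fin n → ℤ => (V.str ((gridPoint (δ : ℝ) a).le_add h3)).hom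
  -- The `3` in `3δ`: one `δ` for the persistent rank and one on each side (`η = δ`) to get past the
  -- envelopes.
  have hrank : ∀ a, Module.rank k (LinearMap.range (φ a)) ≤ N := fun a =>
    rank_str_le hδ hV _ (le_of_eq (by rw [Param.add_add, Param.add_add]; congr 1; ring))
  have hsplit : ∀ a, ∃ (e : LinearMap.range (φ a) →ₗ[k] (Fin N → k))
      (p : (Fin N → k) →ₗ[k] LinearMap.range (φ a)), p ∘ₗ e = LinearMap.id := fun a => by
    obtain ⟨e, he⟩ := rank_le_iff_exists_linearMap.1 (show
      Module.rank k (LinearMap.range (φ a)) ≤ Module.rank k (Fin N → k) by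
        simpa using hrank a)
    exact ⟨e, LinearMap.exists_leftInverse_of_injective e (LinearMap.ker_eq_bot.2 he)⟩
  choose e p hep using hsplit
  have hep' : ∀ a x, p a (e a x) = x := fun a x => LinearMap.congr_fun (hep a) x
  have hmap : ∀ (s t r : Param n) (h : s ≤ t) (h' : t ≤ r) (x : V.obj s),
      (V.str h').hom ((V.str h).hom x) = (V.str (h.trans h')).hom x := fun s t r h h' x => by
    rw [← V.str_comp h h']; rfl
  let ρ : ∀ a b, a ≤ b → LinearMap.range (φ a) →ₗ[k] LinearMap.range (φ b) := fun a b h =>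
    (V.str (Param.add_le_add (gridPoint_mono hδ h) le_rfl)).hom.restrict (by
      rintro _ ⟨x, rfl⟩
      exact ⟨(V.str (gridPoint_mono hδ h)).hom x, (hmap _ _ _ _ _ x).trans (hmap _ _ _ _ _ x).symm⟩)
  classical
  -- The default `0` for incomparable pairs keeps the vanishing claim valid for all pairs.
  refine ⟨fun a b => if h : a ≤ b then ModuleCat.ofHom (e b ∘ₗ ρ a b h ∘ₗ p a) else 0,
    ⟨{ q := fun a => ModuleCat.ofHom (e a ∘ₗ (φ a).rangeRestrict)
       j := fun a => ModuleCat.ofHom ((LinearMap.range (φ a)).subtype ∘ₗ p a)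
       q_j := fun a => ?_
       str_q := fun a b h => ?_
       j_str := fun a b h => ?_
       j_str_q := fun a b h h' => ?_ }⟩, fun a b hab => ?_⟩
  · refine ModuleCat.hom_ext (LinearMap.ext fun x => ?_)
    change ((p a (e a ((φ a).rangeRestrict x)) : LinearMap.range (φ a)) :
      V.obj ((gridPoint (δ : ℝ) a).add (3 * δ))) = _
    rw [hep']
    rfl
  · rw [dif_pos h]
    refine ModuleCat.hom_ext (LinearMap.ext fun x => ?_)
    change e b ((φ b).rangeRestrict _) = e b (ρ a b h (p a (e a ((φ a).rangeRestrict x))))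
    rw [hep']
    congr 1
    exact Subtype.ext ((hmap _ _ _ _ _ x).trans (hmap _ _ _ _ _ x).symm)
  · rw [dif_pos h]
    refine ModuleCat.hom_ext (LinearMap.ext fun x => ?_)
    change _ = ((p b (e b (ρ a b h (p a x))) : LinearMap.range (φ b)) :
      V.obj ((gridPoint (δ : ℝ) b).add (3 * δ)))
    rw [hep']
    rfl
  · rw [dif_pos h]
    refine ModuleCat.hom_ext (LinearMap.ext fun x => ?_)
    change e b ((φ b).rangeRestrict _) = e b (ρ a b h (p a x))
    congr 1
    exact Subtype.ext (hmap _ _ _ _ _ _)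
  · have hzero : ∀ a, (gridPoint δ a : Fin n → ℝ) ∉ B → ∀ x : LinearMap.range (φ a), x = 0 := by
      rintro a ha ⟨_, x, rfl⟩
      have : Subsingleton (V.obj (gridPoint δ a)) := not_nontrivial_iff_subsingleton.1
        fun h => ha (hB h)
      exact Subtype.ext ((congrArg (φ a) (Subsingleton.elim x 0)).trans (map_zero (φ a)))
    beta_reduce
    split_ifs with h
    · refine ModuleCat.hom_ext (LinearMap.ext fun x => ?_)
      change e b (ρ a b h (p a _)) = 0
      by_cases ha : (gridPoint δ a : Fin n → ℝ) ∈ B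
      · rw [hzero b (hab ha) (ρ a b h _), map_zero]
      · rw [hzero a ha (p a _), map_zero, map_zero]
    · rfl

/-! ### Equal grid data give an interleaving -/

namespace GridFactorization

variable {V W : PersMod k n} {D : ModuleCat.{u} k} {M : (Fin n → ℤ) → (Fin n → ℤ) → (D ⟶ D)}

theorem gridCeil_add_le {δ : ℝ} (hδ : 0 < δ) (s : Param n) :
    (gridPoint δ (gridCeil δ s)).add (3 * δ) ≤ s.add (4 * δ) :=
  (Param.add_le_add (gridPoint_gridCeil_le hδ s) le_rfl).trans
    (le_of_eq (by rw [Param.add_add]; congr 1; ring))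

/-- The morphism `V ⟶ W[4δ]` between modules with the same transition maps on the grid. -/
noncomputable def hom {δ : ℝ} {hδ : 0 < δ} (v : GridFactorization V δ hδ D M)
    (w : GridFactorization W δ hδ D M) : V ⟶ W.shift (4 * δ) :=
  mkShift (fun s => V.str (le_gridPoint_gridCeil hδ s) ≫ v.q _ ≫ w.j _ ≫
      W.str (gridCeil_add_le hδ s)) (fun s t h => by
    have h₁ := gridCeil_mono hδ h
    -- Route `V_s ⟶ V_{⌈t⌉}` through `V_{⌈s⌉}`, with `⌈·⌉` rounding up to the grid; the transition
    -- `⌈s⌉ ⟶ ⌈t⌉` then crosses `D` as the common matrix `M` and comes out as a structure map of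
    -- `W`.
    rw [str_comp_assoc, ← str_comp_assoc V (le_gridPoint_gridCeil hδ s) (gridPoint_mono hδ h₁),
      reassoc_of% v.str_q _ _ h₁, ← reassoc_of% w.j_str _ _ h₁]
    simp only [Category.assoc, str_comp])

/-- The portion of the composite inside `W` runs from `D` back to `D`, hence equals a matrix `M a
b`; `V` has the same matrix, so `W` can be eliminated. -/
theorem hom_hom {δ : ℝ} {hδ : 0 < δ} (v : GridFactorization V δ hδ D M)
    (w : GridFactorization W δ hδ D M) (s : Param n) (h : s ≤ (s.add (4 * δ)).add (4 * δ)) :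
    shiftApp (v.hom w) s ≫ shiftApp (w.hom v) (s.add (4 * δ)) = V.str h := by
  change (V.str _ ≫ v.q _ ≫ w.j _ ≫ W.str _) ≫ W.str _ ≫ w.q _ ≫ v.j _ ≫ V.str _ = _
  have h₁ := gridCeil_mono hδ (s.le_add (show 0 ≤ 4 * δ by positivity))
  simp only [Category.assoc, str_comp_assoc]
  -- With `a = ⌈s⌉` and `b = ⌈s + 4δ⌉`, `a + 3δ ≤ s + 4δ ≤ b`, as `j_str_q` requires.
  rw [reassoc_of% w.j_str_q _ _ h₁, ← reassoc_of% v.str_q _ _ h₁, reassoc_of% v.q_j]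
  simp only [str_comp]

theorem interleaved {δ : ℝ≥0} {hδ : 0 < (δ : ℝ)} (v : GridFactorization V δ hδ D M)
    (w : GridFactorization W δ hδ D M) : Interleaved V W (4 * δ) :=
  ⟨v.hom w, w.hom v, fun s => v.hom_hom w s _, fun s => w.hom_hom v s _⟩

end GridFactorization

end PersMod

/-! ### Total boundedness -/

namespace QtSpace

variable {k : Type u} [Field k] {n : ℕ}

theorem totallyBounded_of_persistentRank_le [Finite k] (A : Set (QtSpace k n))
    (hsupp : ∃ B : Set (Fin n → ℝ), Bornology.IsBounded B ∧ ∀ x ∈ A, x.SupportedIn B)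
    (hrank : ∀ ε : ℝ≥0, 0 < ε → ∃ N : ℕ, ∀ x ∈ A, x.persistentRank ε ≤ N) :
    TotallyBounded A := by
  obtain ⟨B, hB, hAB⟩ := hsupp
  refine EMetric.totallyBounded_iff.2 fun ε hε => ?_
  obtain ⟨η, hη, hηε⟩ := ENNReal.lt_iff_exists_nnreal_btwn.1 hε
  -- Equal grid data will give a `4δ`-interleaving, so `δ = η / 4` yields distance at most `η < ε`.
  have hδ : 0 < η / 4 := div_pos (by exact_mod_cast hη) (by norm_num)
  set δ : ℝ≥0 := η / 4
  have hδ' : 0 < (δ : ℝ) := hδ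
  obtain ⟨N, hN⟩ := hrank δ hδ
  let D := ModuleCat.of k (Fin N → k)
  have hex : ∀ x : A, ∃ (V : QtOb k n) (M : (Fin n → ℤ) → (Fin n → ℤ) → (D ⟶ D)), mk V = x.1 ∧
      Nonempty (PersMod.GridFactorization V.obj.toMod δ hδ' D M) ∧
      ∀ a b, ((PersMod.gridPoint δ a : Fin n → ℝ) ∈ B →
        (PersMod.gridPoint δ b : Fin n → ℝ) ∉ B) → M a b = 0 := fun x => by
    obtain ⟨V, hV, hVB⟩ := hAB x.1 x.2
    have hr := hN x.1 x.2
    rw [← hV] at hr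
    obtain ⟨M, h, h'⟩ := V.obj.toMod.exists_gridFactorization δ hδ' hr hVB
    exact ⟨V, M, hV, h, h'⟩
  choose V M hV hM hM0 using hex
  let G := {z : Fin n → ℤ | (PersMod.gridPoint δ z : Fin n → ℝ) ∈ B}
  have : Finite G := PersMod.finite_gridPoint_mem hδ' hB
  have : Finite (D ⟶ D) :=
    Finite.of_injective (fun f (x : Fin N → k) => (f.hom x : Fin N → k)) fun f g h =>
      ModuleCat.hom_ext (LinearMap.ext fun x => congrFun h x)
  -- The invariant with finitely many values: the matrices at the grid points in `B`. All other
  -- matrices are zero, so `c x` determines `M x`.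
  let c : A → G → G → (D ⟶ D) := fun x a b => M x a b
  have hc : ∀ x y, c x = c y → edist x.1 y.1 < ε := fun x y hxy => by
    have hMM : M x = M y := by
      funext a b
      by_cases h : a ∈ G ∧ b ∈ G
      · exact congrFun (congrFun hxy ⟨a, h.1⟩) ⟨b, h.2⟩
      · rw [hM0 x a b fun ha hb => h ⟨ha, hb⟩, hM0 y a b fun ha hb => h ⟨ha, hb⟩]
    obtain ⟨v⟩ := hM x
    obtain ⟨w⟩ := hM y
    rw [← hMM] at w
    rw [← hV x, ← hV y]
    refine lt_of_le_of_lt (iInf₂_le _ (v.interleaved w)) ?_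
    rwa [mul_div_cancel₀ _ (by norm_num)]
  -- The net consists of one class from each nonempty fibre of `c`.
  refine ⟨Set.range fun y => (Set.rangeSplitting c y).1, Set.finite_range _, fun x hx => ?_⟩
  exact Set.mem_biUnion (Set.mem_range_self ⟨c ⟨x, hx⟩, Set.mem_range_self _⟩)
    (hc ⟨x, hx⟩ _ (Set.apply_rangeSplitting c ⟨c ⟨x, hx⟩, Set.mem_range_self _⟩).symm)

end QtSpace

/-! ### Small interleavings and q-tameness -/

namespace PersMod

variable {k : Type u} [Field k] {n : ℕ}

/-- Compose with the interleaving of `W` with itself by structure maps, of parameter `b - a`. -/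
theorem Interleaved.mono {V W : PersMod k n} {a b : ℝ≥0} (h : Interleaved V W a) (hab : a ≤ b) :
    Interleaved V W b := by
  have hs : Interleaved W W (b - a) := by
    let f : W ⟶ W.shift (b - a : ℝ≥0) := mkShift (fun s => W.str (s.le_add (b - a).coe_nonneg))
      (fun s t h => (W.str_comp h _).trans (W.str_comp _ _).symm)
    exact ⟨f, f, fun s => W.str_comp _ _, fun s => W.str_comp _ _⟩
  have := h.trans hs
  rwa [add_tsub_cancel_of_le hab] at this

theorem interleaved_of_interleavingDist_lt {V W : PersMod k n} {a : ℝ≥0}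
    (h : interleavingDist V W < a) : Interleaved V W a := by
  obtain ⟨b, h'⟩ := iInf_lt_iff.1 h
  obtain ⟨hb, hba⟩ := iInf_lt_iff.1 h'
  exact hb.mono (by exact_mod_cast hba.le)

theorem range_comp_finite {X Y Z T : ModuleCat.{u} k} (f : X ⟶ Y) (g : Y ⟶ Z) (h : Z ⟶ T)
    (hg : FiniteDimensional k (LinearMap.range g.hom)) :
    FiniteDimensional k (LinearMap.range (f ≫ g ≫ h).hom) := by
  have e : LinearMap.range (f ≫ g ≫ h).hom ≤ (LinearMap.range g.hom).map h.hom := by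
    rintro _ ⟨x, rfl⟩
    exact ⟨_, ⟨f.hom x, rfl⟩, rfl⟩
  exact Submodule.finiteDimensional_of_le e

theorem QTame.finite_range_str {V : PersMod k n} (hV : V.QTame) {s t : Param n} {ε : ℝ}
    (hε : 0 < ε) (h : s ≤ t) (h' : s ≤ t.add (-ε)) :
    FiniteDimensional k (LinearMap.range (V.str h).hom) := by
  have := range_comp_finite (V.str h') _ (V.str le_rfl) (hV t ε hε)
  rwa [str_comp, str_comp] at this

/-- A module that is interleaved with q-tame modules for arbitrarily small parameters is q-tame. -/
theorem qTame_of_interleaved {V : PersMod k n}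
    (h : ∀ ε : ℝ≥0, 0 < ε → ∃ W : PersMod k n, W.QTame ∧ Interleaved V W ε) : V.QTame := by
  intro s ε hε
  obtain ⟨W, hW, f, g, hfg, -⟩ := h ⟨ε / 4, by positivity⟩ (show 0 < ε / 4 by positivity)
  change V ⟶ W.shift (ε / 4) at f
  change W ⟶ V.shift (ε / 4) at g
  have h₀ : 0 ≤ ε / 4 := by positivity
  have hfg' : ∀ s, shiftApp f s ≫ shiftApp g (s.add (ε / 4)) =
    V.str ((s.le_add h₀).trans ((s.add (ε / 4)).le_add h₀)) := hfg
  have h₁ : ((s.add (-ε)).add (ε / 4)) ≤ s.add (-ε / 4) := by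
    rw [Param.add_add]; exact Param.add_le_add le_rfl (by linarith)
  have h₂ : ((s.add (-ε)).add (ε / 4)) ≤ (s.add (-ε / 4)).add (-(ε / 2)) := by
    rw [Param.add_add, Param.add_add]; exact Param.add_le_add le_rfl (by linarith)
  have h₃ : (s.add (-ε / 4)).add (ε / 4) ≤ s := le_of_eq (by
    rw [Param.add_add, neg_div, neg_add_cancel]; exact funext fun i => add_zero (s i))
  -- The map `V_{s - ε} ⟶ V_s` passes through `W_{s - 3ε/4} ⟶ W_{s - ε/4}`, which has finite rank
  -- because its gap `ε/2` is positive.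
  have e : V.str (s.add_le (neg_nonpos.2 hε.le)) =
      shiftApp f (s.add (-ε)) ≫ W.str h₁ ≫ shiftApp g (s.add (-ε / 4)) ≫ V.str h₃ := by
    rw [shiftApp_naturality_assoc, ← Category.assoc]
    rw [hfg', str_comp, str_comp]
  rw [e]
  exact range_comp_finite _ _ _ (hW.finite_range_str (half_pos hε) h₁ h₂)

/-! ### The colimit of a sequence of successively interleaved modules -/

section Limit

/-- The radius `2 · 2⁻ⁱ`. -/
noncomputable def radius (i : ℕ) : ℝ := 2 * (1 / 2) ^ i

/-- The radius is the tail sum of the interleaving parameters. Thus `f i` becomes an unshifted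
morphism `V_i[-r_i] ⟶ V_{i+1}[-r_{i+1}]`, and `g i` a morphism `V_{i+1}[r_{i+1}] ⟶ V_i[r_i]`. -/
theorem radius_succ (i : ℕ) : radius i = (1 / 2) ^ i + radius (i + 1) := by
  unfold radius; ring

theorem radius_pos (i : ℕ) : 0 < radius i := by unfold radius; positivity

theorem radius_anti : Antitone radius :=
  antitone_nat_of_succ_le fun i => by
    rw [radius_succ i]; exact le_add_of_nonneg_left (by positivity)

variable {V : ℕ → PersMod k n}
variable (f : ∀ i, V i ⟶ (V (i + 1)).shift ((1 / 2) ^ i))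
  (g : ∀ i, V (i + 1) ⟶ (V i).shift ((1 / 2) ^ i))

theorem radius_up (s : Param n) (i : ℕ) :
    (s.add (-radius i)).add ((1 / 2) ^ i) ≤ s.add (-radius (i + 1)) := by
  rw [Param.add_add, radius_succ i]; exact Param.add_le_add le_rfl (by linarith)

theorem radius_down (s : Param n) (i : ℕ) :
    (s.add (radius (i + 1))).add ((1 / 2) ^ i) ≤ s.add (radius i) := by
  rw [Param.add_add, radius_succ i]; exact Param.add_le_add le_rfl (by linarith)

/-- The sequence of the modules `V_i[-r_i]`, where `r_i` is the radius. -/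
noncomputable def upSeq : ℕ ⥤ PersMod k n :=
  Functor.ofSequence (X := fun i => (V i).shift (-radius i)) fun i =>
    { app := fun s => shiftApp (f i) (s.add (-radius i)) ≫ (V (i + 1)).str (radius_up s i)
      naturality := fun s t h => by
        change (V i).str _ ≫ shiftApp (f i) _ ≫ _ = (_ ≫ _) ≫ (V (i + 1)).str _
        rw [shiftApp_naturality_assoc, Category.assoc, str_comp, str_comp] }

/-- The sequence of the modules `V_i[r_i]`, where `r_i` is the radius. -/
noncomputable def downSeq : ℕᵒᵖ ⥤ PersMod k n :=
  Functor.ofOpSequence (X := fun i => (V i).shift (radius i)) fun i =>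
    { app := fun s => shiftApp (g i) (s.add (radius (i + 1))) ≫ (V i).str (radius_down s i)
      naturality := fun s t h => by
        change (V (i + 1)).str _ ≫ shiftApp (g i) _ ≫ _ = (_ ≫ _) ≫ (V i).str _
        rw [shiftApp_naturality_assoc, Category.assoc, str_comp, str_comp] }

/-- The map of `upSeq` between the values at `s`. -/
noncomputable def up {i j : ℕ} (h : i ≤ j) (s : Param n) :
    (V i).obj (s.add (-radius i)) ⟶ (V j).obj (s.add (-radius j)) :=
  ((upSeq f).map (homOfLE h)).app s

/-- The map of `downSeq` between the values at `s`. -/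
noncomputable def down {i j : ℕ} (h : i ≤ j) (s : Param n) :
    (V j).obj (s.add (radius j)) ⟶ (V i).obj (s.add (radius i)) :=
  ((downSeq g).map (homOfLE h).op).app s

theorem up_refl (i : ℕ) (s : Param n) : up f (le_refl i) s = 𝟙 _ :=
  congrArg (fun φ => NatTrans.app φ s) ((upSeq f).map_id i)

theorem down_refl (i : ℕ) (s : Param n) : down g (le_refl i) s = 𝟙 _ :=
  congrArg (fun φ => NatTrans.app φ s) ((downSeq g).map_id (Opposite.op i))

theorem up_trans {i j m : ℕ} (h : i ≤ j) (h' : j ≤ m) (s : Param n) :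
    up f (h.trans h') s = up f h s ≫ up f h' s :=
  congrArg (fun φ => NatTrans.app φ s) ((upSeq f).map_comp (homOfLE h) (homOfLE h'))

theorem down_trans {i j m : ℕ} (h : i ≤ j) (h' : j ≤ m) (s : Param n) :
    down g (h.trans h') s = down g h' s ≫ down g h s :=
  congrArg (fun φ => NatTrans.app φ s) ((downSeq g).map_comp (homOfLE h').op (homOfLE h).op)

theorem up_succ (i : ℕ) (s : Param n) : up f i.le_succ s =
    shiftApp (f i) (s.add (-radius i)) ≫ (V (i + 1)).str (radius_up s i) :=
  congrArg (fun φ : (V i).shift (-radius i) ⟶ (V (i + 1)).shift (-radius (i + 1)) => φ.app s)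
    (Functor.ofSequence_map_homOfLE_succ (X := fun i => (V i).shift (-radius i)) _ i)

theorem down_succ (i : ℕ) (s : Param n) : down g i.le_succ s =
    shiftApp (g i) (s.add (radius (i + 1))) ≫ (V i).str (radius_down s i) :=
  congrArg (fun φ : (V (i + 1)).shift (radius (i + 1)) ⟶ (V i).shift (radius i) => φ.app s)
    (Functor.ofOpSequence_map_homOfLE_succ (X := fun i => (V i).shift (radius i)) _ i)

theorem up_naturality {i j : ℕ} (h : i ≤ j) {s t : Param n} (hst : s ≤ t) :
    (V i).str (Param.add_le_add hst le_rfl) ≫ up f h t =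
      up f h s ≫ (V j).str (Param.add_le_add hst le_rfl) :=
  ((upSeq f).map (homOfLE h)).naturality (homOfLE hst)

theorem down_naturality {i j : ℕ} (h : i ≤ j) {s t : Param n} (hst : s ≤ t) :
    (V j).str (Param.add_le_add hst le_rfl) ≫ down g h t =
      down g h s ≫ (V i).str (Param.add_le_add hst le_rfl) :=
  ((downSeq g).map (homOfLE h).op).naturality (homOfLE hst)

theorem neg_radius_le (s : Param n) (i : ℕ) : s.add (-radius i) ≤ s.add (radius i) :=
  Param.add_le_add le_rfl (neg_le_self (radius_pos i).le)

theorem radius_le_of_le (s : Param n) {i j : ℕ} (h : i ≤ j) :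
    s.add (radius j) ≤ (s.add (2 * radius i)).add (-radius j) := by
  rw [Param.add_add]
  exact Param.add_le_add le_rfl (by linarith [radius_anti h])

variable {f g}

theorem up_down
    (hfg : ∀ i s, shiftApp (f i) s ≫ shiftApp (g i) (s.add ((1 / 2) ^ i)) =
      (V i).str ((s.le_add (by positivity)).trans ((s.add ((1 / 2) ^ i)).le_add (by positivity))))
    {i j : ℕ} (h : i ≤ j) (s : Param n) :
    up f h s ≫ (V j).str (neg_radius_le s j) ≫ down g h s = (V i).str (neg_radius_le s i) := by
  induction j, h using Nat.le_induction with
  | base => rw [up_refl, down_refl, Category.id_comp, Category.comp_id]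
  | succ j h ih =>
    rw [up_trans f h j.le_succ, down_trans g h j.le_succ, up_succ, down_succ, ← ih]
    simp only [Category.assoc, str_comp_assoc, shiftApp_naturality_assoc]
    rw [reassoc_of% hfg j (s.add (-radius j)), str_comp_assoc]

/-- Since `s + r_i = (s + 2r_i) - r_i`, the inverse system at `s` and the direct system at `s +
2r_i` meet at the same point of `V_i`. By induction on `j`, each new innermost pair `f j ∘ g j`
collapses to a structure map. -/
theorem down_up
    (hgf : ∀ i s, shiftApp (g i) s ≫ shiftApp (f i) (s.add ((1 / 2) ^ i)) =
      (V (i + 1)).str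
        ((s.le_add (by positivity)).trans ((s.add ((1 / 2) ^ i)).le_add (by positivity))))
    {i j : ℕ} (h : i ≤ j) (s : Param n) :
    down g h s ≫ (V i).str (radius_le_of_le s le_rfl) ≫ up f h (s.add (2 * radius i)) =
      (V j).str (radius_le_of_le s h) := by
  induction j, h using Nat.le_induction with
  | base => rw [up_refl, down_refl, Category.id_comp, Category.comp_id]
  | succ j h ih =>
    rw [up_trans f h j.le_succ, down_trans g h j.le_succ, Category.assoc, reassoc_of% ih, up_succ,
      down_succ]
    simp only [Category.assoc, str_comp_assoc, shiftApp_naturality_assoc]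
    rw [reassoc_of% hgf j (s.add (radius (j + 1))), str_comp, str_comp]

/-- Going up to a later stage and back down is a structure map by `up_down`, so the map `V_j[-r_j] ⟶
V_i[r_i]` does not depend on the stage where it turns around. This makes the cocone below
compatible. -/
theorem up_str_down_eq
    (hfg : ∀ i s, shiftApp (f i) s ≫ shiftApp (g i) (s.add ((1 / 2) ^ i)) =
      (V i).str ((s.le_add (by positivity)).trans ((s.add ((1 / 2) ^ i)).le_add (by positivity))))
    {i j m m' : ℕ} (hi : i ≤ m) (hj : j ≤ m) (h : m ≤ m') (s : Param n) :
    up f (hj.trans h) s ≫ (V m').str (neg_radius_le s m') ≫ down g (hi.trans h) s =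
      up f hj s ≫ (V m).str (neg_radius_le s m) ≫ down g hi s := by
  rw [up_trans f hj h, down_trans g hi h, ← up_down hfg h s]
  simp only [Category.assoc]

/-- The cocone with point `V_i[r_i]` over the sequence of the `V_j[-r_j]`. -/
noncomputable def fromColimitCocone
    (hfg : ∀ i s, shiftApp (f i) s ≫ shiftApp (g i) (s.add ((1 / 2) ^ i)) =
      (V i).str ((s.le_add (by positivity)).trans ((s.add ((1 / 2) ^ i)).le_add (by positivity))))
    (i : ℕ) : Cocone (upSeq f) where
  pt := (V i).shift (radius i)
  ι :=
    { app := fun j =>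
        { app := fun s => up f (le_max_right i j) s ≫ (V _).str (neg_radius_le s _) ≫
            down g (le_max_left i j) s
          naturality := fun s t h => by
            change (V j).str _ ≫ up f _ t ≫ _ ≫ down g _ t =
              (up f _ s ≫ _ ≫ down g _ s) ≫ (V i).str (Param.add_le_add (leOfHom h) le_rfl)
            rw [reassoc_of% up_naturality f (le_max_right i j) (leOfHom h), Category.assoc,
              Category.assoc, ← down_naturality g (le_max_left i j) (leOfHom h),
              str_comp_assoc, str_comp_assoc] }
      naturality := fun j j' h => by
        ext s : 2
        change up f (leOfHom h) s ≫ up f _ s ≫ _ ≫ down g _ s =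
          (up f _ s ≫ _ ≫ down g _ s) ≫ 𝟙 _
        rw [Category.comp_id, ← Category.assoc, ← up_trans,
          up_str_down_eq hfg (le_max_left i j) (le_max_right i j)
            (max_le_max le_rfl (leOfHom h))] }

/-- The map from the colimit of the `V_j[-r_j]` to `V_i[r_i]`. -/
noncomputable def fromColimit
    (hfg : ∀ i s, shiftApp (f i) s ≫ shiftApp (g i) (s.add ((1 / 2) ^ i)) =
      (V i).str ((s.le_add (by positivity)).trans ((s.add ((1 / 2) ^ i)).le_add (by positivity))))
    (i : ℕ) : colimit (upSeq f) ⟶ (V i).shift (radius i) :=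
  colimit.desc (upSeq f) (fromColimitCocone hfg i)

/-- The map from `V_i[-r_i]` to the colimit at `s`. -/
noncomputable def toColimitAt (f : ∀ i, V i ⟶ (V (i + 1)).shift ((1 / 2) ^ i)) (i : ℕ)
    (s : Param n) : (V i).obj (s.add (-radius i)) ⟶ (colimit (upSeq f)).obj s :=
  (colimit.ι (upSeq f) i).app s

theorem toColimitAt_fromColimit
    (hfg : ∀ i s, shiftApp (f i) s ≫ shiftApp (g i) (s.add ((1 / 2) ^ i)) =
      (V i).str ((s.le_add (by positivity)).trans ((s.add ((1 / 2) ^ i)).le_add (by positivity))))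
    {i m : ℕ} (h : i ≤ m) (s : Param n) :
    toColimitAt f m s ≫ shiftApp (fromColimit hfg i) s =
      (V m).str (neg_radius_le s m) ≫ down g h s := by
  have e : toColimitAt f m s ≫ shiftApp (fromColimit hfg i) s =
      up f (le_max_right i m) s ≫ (V _).str (neg_radius_le s _) ≫ down g (le_max_left i m) s :=
    congrArg (fun φ : (upSeq f).obj m ⟶ (V i).shift (radius i) => φ.app s) 
      (colimit.ι_desc (fromColimitCocone hfg i) m)
  rw [e, up_str_down_eq hfg h le_rfl (le_max_right i m), up_refl, Category.id_comp]

theorem up_toColimitAt {i m : ℕ} (h : i ≤ m) (s : Param n) :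
    up f h s ≫ toColimitAt f m s = toColimitAt f i s :=
  congrArg (fun φ => NatTrans.app φ s) (colimit.w (upSeq f) (homOfLE h))

theorem toColimitAt_naturality (i : ℕ) {s t : Param n} (h : s ≤ t) :
    (V i).str (Param.add_le_add h le_rfl) ≫ toColimitAt f i t =
      toColimitAt f i s ≫ (colimit (upSeq f)).str h :=
  (colimit.ι (upSeq f) i).naturality (homOfLE h)

theorem le_radius_neg_radius (s : Param n) (i : ℕ) :
    s ≤ (s.add (radius i)).add (-radius i) := by
  rw [Param.add_add]; exact s.le_add (add_neg_cancel (radius i)).ge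

/-- The map from `V_i` to the shift of the colimit of the `V_j[-r_j]` by `r_i`. -/
noncomputable def toColimit (f : ∀ i, V i ⟶ (V (i + 1)).shift ((1 / 2) ^ i)) (i : ℕ) :
    V i ⟶ (colimit (upSeq f)).shift (radius i) :=
  mkShift (fun s => (V i).str (le_radius_neg_radius s i) ≫
      toColimitAt f i (s.add (radius i))) fun s t h => by
    rw [Category.assoc, ← toColimitAt_naturality, str_comp_assoc, str_comp_assoc]

/-- Evaluation at `s` preserves the colimit, and the stages `m ≥ i` are cofinal. -/
theorem colimit_hom_ext {s : Param n} {X : ModuleCat.{u} k} {φ ψ : (colimit (upSeq f)).obj s ⟶ X}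
    (i : ℕ) (h : ∀ m, i ≤ m →
      toColimitAt f m s ≫ φ = toColimitAt f m s ≫ ψ) : φ = ψ := by
  refine (isColimitOfPreserves ((evaluation _ _).obj s) (colimit.isColimit (upSeq f))).hom_ext
    fun j => ?_
  change toColimitAt f j s ≫ φ = toColimitAt f j s ≫ ψ
  rw [← up_toColimitAt (le_max_right i j) s, Category.assoc, Category.assoc, h _ (le_max_left i j)]

theorem interleaved_colimit
    (hfg : ∀ i s, shiftApp (f i) s ≫ shiftApp (g i) (s.add ((1 / 2) ^ i)) =
      (V i).str ((s.le_add (by positivity)).trans ((s.add ((1 / 2) ^ i)).le_add (by positivity))))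
    (hgf : ∀ i s, shiftApp (g i) s ≫ shiftApp (f i) (s.add ((1 / 2) ^ i)) =
      (V (i + 1)).str
        ((s.le_add (by positivity)).trans ((s.add ((1 / 2) ^ i)).le_add (by positivity))))
    (i : ℕ) : Interleaved (V i) (colimit (upSeq f)) ⟨radius i, (radius_pos i).le⟩ := by
  refine ⟨toColimit f i, fromColimit hfg i, fun s => ?_, fun s => ?_⟩
  · change (_ ≫ _) ≫ shiftApp (fromColimit hfg i) (s.add (radius i)) = _
    rw [Category.assoc, toColimitAt_fromColimit hfg le_rfl, down_refl, Category.comp_id, str_comp]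
    rfl
  · refine colimit_hom_ext i fun m hm => ?_
    change _ ≫ shiftApp (fromColimit hfg i) s ≫ (V i).str _ ≫
      toColimitAt f i ((s.add (radius i)).add (radius i)) = _
    have h2 : s.add (2 * radius i) ≤ (s.add (radius i)).add (radius i) := by
      rw [Param.add_add, two_mul]
    -- Tested on stage `m`, the composite goes down to `V_i` and re-enters the colimit from there.
    -- Entering through stage `m` instead produces down followed by up, which `down_up` turns into a
    -- structure map of `V_m`.
    rw [reassoc_of% toColimitAt_fromColimit hfg hm s, ← up_toColimitAt hm,
      ← str_comp_assoc (V i) (radius_le_of_le s le_rfl) (Param.add_le_add h2 le_rfl),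
      reassoc_of% up_naturality f hm h2, reassoc_of% down_up hgf hm s, str_comp_assoc,
      str_comp_assoc, ← toColimitAt_naturality]
    rfl

end Limit
end PersMod

/-! ### Completeness -/

namespace QtSpace

variable {k : Type u} [Field k] {n : ℕ}

theorem exists_tendsto (x : ℕ → QtSpace k n)
    (hx : ∀ N i j : ℕ, N ≤ i → N ≤ j → edist (x i) (x j) < (((1 / 2) ^ N : ℝ≥0) : ℝ≥0∞)) :
    ∃ y, Filter.Tendsto x Filter.atTop (nhds y) := by
  have hrep : ∀ i, ∃ V : QtOb k n, mk V = x i := fun i => Quotient.exists_rep (x i)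
  choose V hV using hrep
  have hI : ∀ i, PersMod.Interleaved (V i).obj.toMod (V (i + 1)).obj.toMod
      ⟨(1 / 2) ^ i, by positivity⟩ := fun i =>
    PersMod.interleaved_of_interleavingDist_lt (by
      have := hx i i (i + 1) le_rfl i.le_succ
      rw [← hV, ← hV] at this
      exact this.trans_eq (congrArg _ (NNReal.eq (by push_cast; rfl))))
  -- The same interleavings, with the nonnegative parameter unfolded to the real number `(1 / 2) ^
  -- i`.
  have hI' : ∀ i, ∃ (f : (V i).obj.toMod ⟶ (V (i + 1)).obj.toMod.shift ((1 / 2) ^ i))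
      (g : (V (i + 1)).obj.toMod ⟶ (V i).obj.toMod.shift ((1 / 2) ^ i)),
      (∀ s, PersMod.shiftApp f s ≫ PersMod.shiftApp g (s.add ((1 / 2) ^ i)) =
        (V i).obj.toMod.str
          ((s.le_add (by positivity)).trans ((s.add ((1 / 2) ^ i)).le_add (by positivity)))) ∧
      (∀ s, PersMod.shiftApp g s ≫ PersMod.shiftApp f (s.add ((1 / 2) ^ i)) =
        (V (i + 1)).obj.toMod.str
          ((s.le_add (by positivity)).trans ((s.add ((1 / 2) ^ i)).le_add (by positivity)))) := hI
  choose f g hfg hgf using hI'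
  have hC := PersMod.interleaved_colimit hfg hgf
  have hlim : Filter.Tendsto PersMod.radius Filter.atTop (nhds 0) := by
    have := (tendsto_pow_atTop_nhds_zero_of_lt_one (r := (1 / 2 : ℝ)) (by norm_num)
      (by norm_num)).const_mul 2
    rwa [mul_zero] at this
  -- The colimit lies in the space because it is `r_i`-interleaved with the q-tame `V_i` and `r_i →
  -- 0`.
  have hq : (colimit (PersMod.upSeq f)).QTame := PersMod.qTame_of_interleaved fun ε hε => by
    obtain ⟨i, hi⟩ := (hlim.eventually_lt_const (show (0 : ℝ) < ε from hε)).exists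
    exact ⟨_, (V i).property, (hC i).symm.mono (show PersMod.radius i ≤ ε from hi.le)⟩
  refine ⟨mk ⟨⟨colimit (PersMod.upSeq f)⟩, hq⟩, EMetric.tendsto_atTop.2 fun ε hε => ?_⟩
  obtain ⟨η, hη, hηε⟩ := ENNReal.lt_iff_exists_nnreal_btwn.1 hε
  obtain ⟨N, hN⟩ := Filter.eventually_atTop.1
    (hlim.eventually_lt_const (show (0 : ℝ) < η by exact_mod_cast hη))
  refine ⟨N, fun i hi => lt_of_le_of_lt ?_ hηε⟩
  rw [← hV i]
  exact iInf₂_le η ((hC i).mono (show PersMod.radius i ≤ η from (hN i hi).le))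

/-- It suffices that Cauchy sequences with the prescribed rate `2⁻ᴺ` converge; this summable rate is
what makes the radii finite. -/
instance : CompleteSpace (QtSpace k n) :=
  EMetric.complete_of_convergent_controlled_sequences
    (fun N => (((1 / 2) ^ N : ℝ≥0) : ℝ≥0∞)) (fun N => ENNReal.coe_pos.2 (by positivity))
    exists_tendsto

end QtSpace

theorem mainTheorem10 {k : Type u} [Field k] [Finite k] {n : ℕ} (A : Set (QtSpace k n))
    (hsupp : ∃ B : Set (Fin n → ℝ), Bornology.IsBounded B ∧ ∀ x ∈ A, x.SupportedIn B)
    (hrank : ∀ ε : ℝ≥0, 0 < ε → ∃ N : ℕ, ∀ x ∈ A, x.persistentRank ε ≤ N) :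
    IsCompact (closure A) :=
  (QtSpace.totallyBounded_of_persistentRank_le A hsupp hrank).closure.isCompact_of_isClosed
    isClosed_closure
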